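/- Let $n \ge 2$, let $\iota \in \mathbb{R}^n$ be a unit vector, and let $\mathcal{H}$ be the group of all orthonormal $n\times n$ matrices. Consider the location model $X = \iota\mu + \varepsilon$, where $\mu\in\mathbb{R}$ and $\varepsilon$ is a random $n$-vector, and the problem of testing $H_0 : \mu = 0$ at level $\alpha \in (0,1)$. For finitely many (possibly repeated) values, their $\alpha$ upper-quantile is the smallest $t$ such that the proportion of the values exceeding $t$ is at most $\alpha$. Let $M \ge 1$. - Monte Carlo orthogonal group-invariance test $\phi_\alpha^{\mathcal{H}_M}$: let $\mathcal{H}_M = (I, H_1, \dots, H_{M-1})$, where $H_1,\dots,H_{M-1}$ are independent, uniformly (Haar) distributed on $\mathcal{H}$, and independent of $\varepsilon$. The test rejects if $\iota'X$ exceeds the $\alpha$ upper-quantile of the $M$ values $\iota'X, \iota'H_1X, \dots, \iota'H_{M-1}X$. - $M$-draw Monte Carlo $t_{n-1}$-test: let $T(X) = \iota'X/\widehat\sigma$ with $\widehat\sigma = \sqrt{X'(I-\iota\iota')X/(n-1)}$ (if $\widehat\sigma = 0$, put $T(X) = +\infty$ when $\iota'X > 0$ and $T(X) = -\infty$ otherwise),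 and let $t_1,\dots,t_{M-1}$ be independent draws from Student's $t$-distribution with $n-1$ degrees of freedom, independent of $\varepsilon$. The test rejects if $T(X)$ exceeds the $\alpha$ upper-quantile of the $M$ values $T(X), t_1, \dots, t_{M-1}$. Then the two tests have the same size and the same power. That is, for every $\mu \in \mathbb{R}$ and every distribution of $\varepsilon$ (in particular every $\mathcal{H}$-invariant one) the two tests reject with the same probability; and the suprema of their rejection probabilities under $\mu = 0$, taken over all $\mathcal{H}$-invariant distributions of $\varepsilon$, coincide. -/

import Mathlib

open MeasureTheory ProbabilityTheory
open scoped ENNReal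

noncomputable section

namespace OrthInv

/-- Euclidean `n`-space. -/
abbrev E (n : ℕ) : Type := EuclideanSpace ℝ (Fin n)

/-! ### The orthogonal group and its uniform distribution -/

/-- The group of all orthonormal `n × n` matrices, with the topology of entrywise convergence. -/
abbrev O (n : ℕ) : Type := Matrix.orthogonalGroup (Fin n) ℝ

instance instMeasurableSpaceO (n : ℕ) : MeasurableSpace (O n) := borel _

instance instBorelSpaceO (n : ℕ) : BorelSpace (O n) := ⟨rfl⟩

instance instCompactSpaceO (n : ℕ) : CompactSpace (O n) := by
  have hK : IsCompact
      (Set.pi Set.univ fun _ : Fin n => Set.pi Set.univ fun _ : Fin n => Set.Icc (-1 : ℝ) 1) :=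
    isCompact_univ_pi fun _ => isCompact_univ_pi fun _ => isCompact_Icc
  have hc : IsClosed ((Matrix.orthogonalGroup (Fin n) ℝ : Submonoid (Matrix (Fin n) (Fin n) ℝ)) :
      Set (Matrix (Fin n) (Fin n) ℝ)) := isClosed_unitary
  refine isCompact_iff_compactSpace.mp (hK.of_isClosed_subset hc ?_)
  intro U hU i _ j _
  have h := entry_norm_bound_of_unitary (𝕜 := ℝ) hU i j
  exact abs_le.mp h

/-- The uniform distribution on the orthogonal group: Haar measure of total mass one. -/
def uniformO (n : ℕ) : Measure (O n) := Measure.haarMeasure ⊤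

instance instIsProbabilityMeasureUniformO (n : ℕ) : IsProbabilityMeasure (uniformO n) :=
  ⟨by simpa [uniformO] using Measure.haarMeasure_self (K₀ := (⊤ : TopologicalSpace.PositiveCompacts (O n)))⟩

/-- The action of an orthonormal matrix on a vector, `x ↦ H x`. -/
def act {n : ℕ} (H : O n) (x : E n) : E n :=
  Matrix.toEuclideanCLM (n := Fin n) (𝕜 := ℝ) (H : Matrix (Fin n) (Fin n) ℝ) x

/-- A distribution of a random `n`-vector is orthogonally invariant if `H ε` has the same
distribution as `ε` for every orthonormal matrix `H`. -/
def IsOrthInvariant {n : ℕ} (ν : Measure (E n)) : Prop :=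
  ∀ H : O n, ν.map (act H) = ν

/-! ### Upper quantiles -/

/-- The `α` upper-quantile of the uniform distribution on the (finitely many, possibly repeated)
values `v j`: the smallest `t` such that the proportion of values exceeding `t` is at most `α`. -/
def upperQuantile {κ R : Type*} [Fintype κ] [ConditionallyCompleteLinearOrder R]
    (α : ℝ) (v : κ → R) : R :=
  sInf {t : R | ((Finset.univ.filter fun j => t < v j).card : ℝ) ≤ α * (Fintype.card κ : ℝ)}

/-! ### The Monte Carlo orthogonal group-invariance test -/

/-- The Monte Carlo reference collection: the identity followed by the `M - 1` drawn matrices. -/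
def mcGroupSample {n M : ℕ} (h : Fin (M - 1) → O n) : Fin (M - 1 + 1) → O n :=
  Fin.cons 1 h

/-- The Monte Carlo orthogonal group-invariance test, with test statistic `x ↦ ι'x`, rejects at the
data `x` and the drawn matrices `h`: `ι'x` exceeds the `α` upper-quantile of `ι'Gx`, where `G` is
uniform on the reference collection. -/
def mcGroupTest {n : ℕ} (ι : E n) (α : ℝ) (M : ℕ) (x : E n) (h : Fin (M - 1) → O n) : Prop :=
  upperQuantile α (fun j => inner ℝ ι (act (mcGroupSample h j) x)) < inner ℝ ι x

/-! ### The Monte Carlo `t`-test -/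

/-- Student's `t`-distribution with `k ≥ 1` degrees of freedom: the law of `Z / √(V / k)`, where
`Z` is standard normal and `V` is an independent sum of `k` squared independent standard
normals. -/
def studentT (k : ℕ) : Measure ℝ :=
  ((gaussianReal 0 1).prod (Measure.pi fun _ : Fin k => gaussianReal 0 1)).map
    fun p => p.1 / Real.sqrt ((∑ i, p.2 i ^ 2) / (k : ℝ))

/-- The residual standard deviation `√(x'(I - ιι')x / (n - 1))`. -/
def sigmaHat {n : ℕ} (ι x : E n) : ℝ :=
  Real.sqrt (inner ℝ x (x - (inner ℝ ι x : ℝ) • ι) / ((n : ℝ) - 1))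

/-- The `t`-statistic `ι'x / σ̂`. When `σ̂ = 0` it is `+∞` if `ι'x > 0`, and `-∞` otherwise. -/
def tStat {n : ℕ} (ι x : E n) : EReal :=
  if 0 < sigmaHat ι x then ((inner ℝ ι x / sigmaHat ι x : ℝ) : EReal)
  else if 0 < (inner ℝ ι x : ℝ) then ⊤ else ⊥

/-- The Monte Carlo `t`-test rejects at the data `x` and the draws `t` from the null distribution:
the observed `t`-statistic exceeds the `α` upper-quantile of the `M` values consisting of itself
and the `M - 1` draws. -/
def mcTTest {n : ℕ} (ι : E n) (α : ℝ) (M : ℕ) (x : E n) (t : Fin (M - 1) → ℝ) : Prop :=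
  upperQuantile α
    (Fin.cons (tStat ι x) (fun i => (t i : EReal)) : Fin (M - 1 + 1) → EReal) < tStat ι x

/-! ### Rejection probabilities in the location model `X = ιμ + ε` -/

/-- The probability that a test rejects in the model `X = ιμ + ε`, when `ε` has law `ν` and the
test uses auxiliary randomness with law `Q`, independent of `ε`. As a function of `μ` and `ν`
this is the power function of the test. -/
def power {n : ℕ} {R : Type*} [MeasurableSpace R] (ι : E n) (Q : Measure R)
    (reject : E n → R → Prop) (μ : ℝ) (ν : Measure (E n)) : ℝ≥0∞ :=
  (ν.prod Q) {p | reject (μ • ι + p.1) p.2}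

/-- The size of a test of `H₀ : μ = 0`: the supremum of its rejection probabilities under the null
hypothesis, over all orthogonally invariant distributions of `ε`. -/
def size {n : ℕ} {R : Type*} [MeasurableSpace R] (ι : E n) (Q : Measure R)
    (reject : E n → R → Prop) : ℝ≥0∞ :=
  ⨆ (ν : Measure (E n)) (_ : IsProbabilityMeasure ν) (_ : IsOrthInvariant ν),
    power ι Q reject 0 ν

/-- The law of `M - 1` independent uniform draws from the orthogonal group. -/
def groupDraws (n M : ℕ) : Measure (Fin (M - 1) → O n) :=
  Measure.pi fun _ => uniformO n

/-- The law of `M - 1` independent draws from the `t`-distribution with `k` degrees of freedom. -/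
def tDraws (k M : ℕ) : Measure (Fin (M - 1) → ℝ) :=
  Measure.pi fun _ => studentT k

end OrthInv

end

namespace OrthInv

/-! ### The action of the orthogonal group -/

/-! Condition on the data `x`. Both tests then reject according to how many draws are at least the
observed value (`RankRejects`), so only the ordering of the statistics matters. Orthonormal matrices
preserve the norm, and on a sphere `tStat ι` is strictly increasing in `ι'x`; the group test is
therefore unchanged when `ι'x` is replaced by `tStat ι` (`mcGroupTest_iff`). For `x ≠ 0` and `H`
uniform, `tStat ι (act H x)` has Student's law (`map_tStat_act_uniformO`): its law does not depend
on `x`, so `x` may be taken standard Gaussian, and then `H x` is Gaussian too. At `x = 0` neither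
test rejects. The conditional rejection probabilities thus agree for every `x`; Fubini gives equal
power, and the sizes are suprema of equal quantities. -/

lemma act_one {n : ℕ} (x : E n) : act 1 x = x := by simp [act]

lemma act_mul {n : ℕ} (G H : O n) (x : E n) : act (G * H) x = act G (act H x) := by
  simp [act]

lemma act_smul {n : ℕ} (H : O n) (c : ℝ) (x : E n) : act H (c • x) = c • act H x := by
  simp [act]

/-- The linear isometry given by an orthonormal matrix. -/
noncomputable def actIsometry {n : ℕ} (H : O n) : E n ≃ₗᵢ[ℝ] E n :=
  Unitary.linearIsometryEquiv
    ⟨Matrix.toEuclideanCLM (n := Fin n) (𝕜 := ℝ) (H : Matrix (Fin n) (Fin n) ℝ),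
      Unitary.map_mem (Matrix.toEuclideanCLM (n := Fin n) (𝕜 := ℝ)) H.2⟩

lemma norm_act {n : ℕ} (H : O n) (x : E n) : ‖act H x‖ = ‖x‖ :=
  (actIsometry H).norm_map x

/-- For equal norms, the reflection in the hyperplane orthogonal to `x - y` swaps `x` and `y`. -/
lemma exists_act_eq {n : ℕ} {x y : E n} (h : ‖x‖ = ‖y‖) : ∃ H : O n, act H x = y := by
  let u := Unitary.linearIsometryEquiv.symm ((ℝ ∙ (x - y))ᗮ.reflection)
  refine ⟨⟨(Matrix.toEuclideanCLM (n := Fin n) (𝕜 := ℝ)).symm (u : E n →L[ℝ] E n),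
    Unitary.map_mem (Matrix.toEuclideanCLM (n := Fin n) (𝕜 := ℝ)).symm u.2⟩, ?_⟩
  simp only [act, StarAlgEquiv.apply_symm_apply]
  exact Submodule.reflection_sub h

lemma continuous_act {n : ℕ} : Continuous fun p : O n × E n => act p.1 p.2 := by
  unfold act
  have : (fun p : O n × E n => Matrix.toEuclideanCLM (n := Fin n) (𝕜 := ℝ)
      (p.1 : Matrix (Fin n) (Fin n) ℝ) p.2) =
      fun p => WithLp.toLp 2 ((p.1 : Matrix (Fin n) (Fin n) ℝ).mulVec (WithLp.ofLp p.2)) := by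
    ext p i; simp
  rw [this]
  refine (PiLp.continuous_toLp 2 _).comp ?_
  exact Continuous.matrix_mulVec (by fun_prop) (by fun_prop)

instance instSecondCountableTopologyO (n : ℕ) : SecondCountableTopology (O n) := by
  have : SecondCountableTopology (Matrix (Fin n) (Fin n) ℝ) :=
    inferInstanceAs (SecondCountableTopology (Fin n → Fin n → ℝ))
  exact TopologicalSpace.Subtype.secondCountableTopology _

lemma measurable_act {n : ℕ} : Measurable fun p : O n × E n => act p.1 p.2 :=
  continuous_act.measurable

lemma _root_.Measurable.orthAct {n : ℕ} {γ : Type*} [MeasurableSpace γ] {f : γ → O n} {g : γ → E n}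
    (hf : Measurable f) (hg : Measurable g) : Measurable fun c => act (f c) (g c) := by
  have h1 := hf.prodMk hg
  have h2 := measurable_act.comp h1
  exact h2

/-- Compact groups are unimodular: the pushforward is still left-invariant, hence a multiple of Haar
measure, and total mass one fixes the factor. -/
lemma map_mul_right_uniformO {n : ℕ} (G : O n) :
    (uniformO n).map (· * G) = uniformO n := by
  have : (uniformO n).IsHaarMeasure := by unfold uniformO; infer_instance
  have hG : Measurable (fun H : O n => H * G) := (continuous_mul_const G).measurable
  have : IsProbabilityMeasure ((uniformO n).map (· * G)) :=
    Measure.isProbabilityMeasure_map hG.aemeasurable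
  have h := Measure.isMulInvariant_eq_smul_of_compactSpace ((uniformO n).map (· * G)) (uniformO n)
  have h1 := congrArg (fun m : Measure (O n) => m Set.univ) h
  simp only [measure_univ, Measure.smul_apply] at h1
  have h2 : Measure.haarScalarFactor ((uniformO n).map (· * G)) (uniformO n) = 1 := by
    simpa [ENNReal.smul_def] using h1.symm
  rw [h, h2, one_smul]

/-! ### Upper quantiles -/

lemma upperQuantile_lt_iff {κ R : Type*} [Fintype κ] [ConditionallyCompleteLinearOrder R]
    {α : ℝ} (hα0 : 0 < α) (hα1 : α < 1) (v : κ → R) (i : κ) :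
    upperQuantile α v < v i ↔
      ((Finset.univ.filter fun j => v i ≤ v j).card : ℝ) ≤ α * (Fintype.card κ : ℝ) := by
  have : Nonempty κ := ⟨i⟩
  have hκ : (0 : ℝ) < Fintype.card κ := by exact_mod_cast Fintype.card_pos
  -- Since `α < 1`, no admissible threshold lies below all the values; this bounds `S` below and
  -- rules out rejection at the minimum.
  have key : ∀ c : R, (∀ j, c ≤ v j) →
      ¬ ((Finset.univ.filter fun j => c ≤ v j).card : ℝ) ≤ α * (Fintype.card κ : ℝ) := by
    intro c hc h
    rw [Finset.filter_true_of_mem (fun j _ => hc j), Finset.card_univ] at h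
    nlinarith
  set S := {t : R | ((Finset.univ.filter fun j => t < v j).card : ℝ) ≤ α * (Fintype.card κ : ℝ)}
  have hbdd : BddBelow S := by
    obtain ⟨k, hk⟩ := Finite.exists_min v
    refine ⟨v k, fun t ht => ?_⟩
    by_contra! hlt
    refine key (v k) hk (le_trans ?_ ht)
    exact_mod_cast Finset.card_le_card fun j hj => by
      simp only [Finset.mem_filter, Finset.mem_univ, true_and] at hj ⊢
      exact hlt.trans_le hj
  have hne : S.Nonempty := by
    obtain ⟨k, hk⟩ := Finite.exists_max v
    refine ⟨v k, ?_⟩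
    have : (Finset.univ.filter fun j => v k < v j) = ∅ := by
      simp [Finset.filter_eq_empty_iff, hk]
    simp only [S, Set.mem_ofPred_eq, this, Finset.card_empty, Nat.cast_zero]
    positivity
  change sInf S < v i ↔ _
  rw [csInf_lt_iff hbdd hne]
  constructor
  · rintro ⟨t, ht, hti⟩
    refine le_trans ?_ ht
    exact_mod_cast Finset.card_le_card fun j hj => by
      simp only [Finset.mem_filter, Finset.mem_univ, true_and] at hj ⊢
      exact hti.trans_le hj
  · intro h
    have hex : (Finset.univ.filter fun j => v j < v i).Nonempty := by
      by_contra hemp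
      rw [Finset.not_nonempty_iff_eq_empty, Finset.filter_eq_empty_iff] at hemp
      exact key (v i) (fun j => not_lt.1 (hemp (Finset.mem_univ j))) h
    -- The largest value below `v i` is a witness: whatever exceeds it is at least `v i`.
    obtain ⟨k, hk, hmax⟩ := Finset.exists_max_image _ v hex
    simp only [Finset.mem_filter, Finset.mem_univ, true_and] at hk hmax
    refine ⟨v k, ?_, hk⟩
    refine le_trans ?_ h
    exact_mod_cast Finset.card_le_card fun j hj => by
      simp only [Finset.mem_filter, Finset.mem_univ, true_and] at hj ⊢
      exact not_lt.1 fun hlt => (hmax j hlt).not_gt hj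

/-! ### The `t`-statistic -/

lemma sigmaHat_eq {n : ℕ} (ι x : E n) :
    sigmaHat ι x = Real.sqrt ((‖x‖ ^ 2 - (inner ℝ ι x : ℝ) ^ 2) / ((n : ℝ) - 1)) := by
  rw [sigmaHat, inner_sub_right, inner_smul_right, real_inner_self_eq_norm_sq,
    real_inner_comm x ι, sq (inner ℝ x ι)]

lemma measurable_tStat {n : ℕ} (ι : E n) : Measurable (tStat ι) := by
  have h1 : Measurable fun x : E n => (inner ℝ ι x : ℝ) := by fun_prop
  have h2 : Measurable (sigmaHat ι) := by
    simp only [funext (sigmaHat_eq ι)]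
    fun_prop
  refine Measurable.ite (measurableSet_lt measurable_const h2) ?_ ?_
  · exact (h1.div h2).coe_real_ereal
  · exact Measurable.ite (measurableSet_lt measurable_const h1) measurable_const measurable_const

lemma _root_.Measurable.orthTStat {n : ℕ} (ι : E n) {γ : Type*} [MeasurableSpace γ] {f : γ → E n}
    (hf : Measurable f) : Measurable fun c => tStat ι (f c) :=
  (measurable_tStat ι).comp hf

lemma tStat_smul {n : ℕ} (ι x : E n) {c : ℝ} (hc : 0 < c) : tStat ι (c • x) = tStat ι x := by
  have hs : sigmaHat ι (c • x) = c * sigmaHat ι x := by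
    rw [sigmaHat_eq, sigmaHat_eq, norm_smul, inner_smul_right, Real.norm_of_nonneg hc.le, mul_pow,
      mul_pow, ← mul_sub, mul_div_assoc, Real.sqrt_mul (sq_nonneg c), Real.sqrt_sq hc.le]
  simp only [tStat, hs, inner_smul_right, mul_pos_iff_of_pos_left hc,
    mul_div_mul_left _ _ hc.ne']

/-- On the sphere of radius `r`, with `a = ι'x`, the statistic is `√(n-1) · a / √(r² - a²)`,
strictly increasing on `(-r, r)`. The degenerate case `σ̂ = 0` occurs exactly at `a = ±r`, where the
values `±∞` extend the monotonicity (`r = 0` leaves no strict inequality). -/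
lemma tStat_lt_tStat {n : ℕ} (hn : 2 ≤ n) {ι x y : E n} (hι : ‖ι‖ = 1) (hxy : ‖x‖ = ‖y‖)
    (h : (inner ℝ ι x : ℝ) < inner ℝ ι y) : tStat ι x < tStat ι y := by
  have hn' : (0 : ℝ) < (n : ℝ) - 1 := by
    have : (2 : ℝ) ≤ n := by exact_mod_cast hn
    linarith
  have hpos : ∀ z : E n, 0 < sigmaHat ι z ↔ |(inner ℝ ι z : ℝ)| < ‖z‖ := by
    intro z
    rw [sigmaHat_eq, Real.sqrt_pos, div_pos_iff_of_pos_right hn', sub_pos, sq_lt_sq,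
      abs_norm]
  have habs : ∀ z : E n, |(inner ℝ ι z : ℝ)| ≤ ‖z‖ := fun z => by
    simpa [hι] using abs_real_inner_le_norm ι z
  have hx := abs_le.1 (habs x)
  have hy := abs_le.1 (habs y)
  by_cases hsx : 0 < sigmaHat ι x
  · have hx' := abs_lt.1 ((hpos x).1 hsx)
    by_cases hsy : 0 < sigmaHat ι y
    · have hy' := abs_lt.1 ((hpos y).1 hsy)
      rw [tStat, tStat, if_pos hsx, if_pos hsy, EReal.coe_lt_coe_iff, div_lt_div_iff₀ hsx hsy]
      set a : ℝ := inner ℝ ι x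
      set b : ℝ := inner ℝ ι y
      have e1 : sigmaHat ι x ^ 2 = (‖x‖ ^ 2 - a ^ 2) / ((n : ℝ) - 1) := by
        rw [sigmaHat_eq, Real.sq_sqrt]
        exact div_nonneg (by nlinarith) hn'.le
      have e2 : sigmaHat ι y ^ 2 = (‖x‖ ^ 2 - b ^ 2) / ((n : ℝ) - 1) := by
        rw [sigmaHat_eq, Real.sq_sqrt, hxy]
        exact div_nonneg (by nlinarith) hn'.le
      set s := sigmaHat ι x
      set u := sigmaHat ι y
      have hr : 0 < ‖x‖ := by linarith
      -- The cross-multiplied inequality is compared through squares; the signs of `a` and `b`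
      -- decide the direction.
      have hdiff : (b * s) ^ 2 - (a * u) ^ 2 = ‖x‖ ^ 2 / ((n : ℝ) - 1) * (b ^ 2 - a ^ 2) := by
        rw [mul_pow, mul_pow, e1, e2]; ring
      have hq : 0 < ‖x‖ ^ 2 / ((n : ℝ) - 1) := by positivity
      rcases le_or_gt b 0 with hb | hb
      · have h1 := mul_neg_of_pos_of_neg hq (show b ^ 2 - a ^ 2 < 0 by nlinarith)
        have h2 : (b * s) ^ 2 < (a * u) ^ 2 := by linarith
        have h3 := sq_lt_sq.1 h2
        rw [abs_of_nonpos (mul_nonpos_of_nonpos_of_nonneg hb hsx.le),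
          abs_of_nonpos (mul_nonpos_of_nonpos_of_nonneg (by linarith) hsy.le)] at h3
        linarith
      · rcases le_or_gt a 0 with ha | ha
        · exact lt_of_le_of_lt (mul_nonpos_of_nonpos_of_nonneg ha hsy.le) (mul_pos hb hsx)
        · refine lt_of_pow_lt_pow_left₀ 2 (mul_pos hb hsx).le ?_
          have h1 := mul_pos hq (show 0 < b ^ 2 - a ^ 2 by nlinarith)
          linarith
    · have hy' := mt (hpos y).2 hsy
      have : (0 : ℝ) < inner ℝ ι y := by
        by_contra! hle
        rw [abs_of_nonpos hle] at hy'
        linarith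
      rw [tStat, tStat, if_pos hsx, if_neg hsy, if_pos this]
      exact EReal.coe_lt_top _
  · have hx' := mt (hpos x).2 hsx
    have hx0 : ¬ (0 : ℝ) < inner ℝ ι x := by
      intro h0
      rw [abs_of_pos h0] at hx'
      linarith
    rw [tStat, if_neg hsx, if_neg hx0, bot_lt_iff_ne_bot, tStat]
    split_ifs with h1 h2
    · exact EReal.coe_ne_bot _
    · exact top_ne_bot
    · have hy' := mt (hpos y).2 h1
      rw [abs_of_nonpos (not_lt.1 h2)] at hy'
      linarith

lemma tStat_le_tStat_iff {n : ℕ} (hn : 2 ≤ n) {ι x y : E n} (hι : ‖ι‖ = 1) (hxy : ‖x‖ = ‖y‖) :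
    tStat ι x ≤ tStat ι y ↔ (inner ℝ ι x : ℝ) ≤ inner ℝ ι y := by
  refine ⟨fun h => not_lt.1 fun hlt => (tStat_lt_tStat hn hι hxy.symm hlt).not_ge h, fun h => ?_⟩
  rcases h.lt_or_eq with h | h
  · exact (tStat_lt_tStat hn hι hxy h).le
  · simp only [tStat, sigmaHat_eq, hxy, h, le_refl]

lemma tStat_zero {n : ℕ} (ι : E n) : tStat ι 0 = ⊥ := by
  simp [tStat, sigmaHat]

/-! ### The law of the `t`-statistic -/

lemma tStat_sum_smul {k : ℕ} (b : OrthonormalBasis (Fin (k + 1)) ℝ (E (k + 1)))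
    (x : Fin (k + 1) → ℝ) {i : Fin k} (hi : x i.succ ≠ 0) :
    tStat (b 0) (∑ j, x j • b j) =
      ((x 0 / Real.sqrt ((∑ j : Fin k, x j.succ ^ 2) / (k : ℝ)) : ℝ) : EReal) := by
  have h1 : (inner ℝ (b 0) (∑ j, x j • b j) : ℝ) = x 0 := b.orthonormal.inner_right_fintype x 0
  have h2 : ‖∑ j, x j • b j‖ ^ 2 = ∑ j, x j ^ 2 := by
    rw [← b.sum_sq_inner_right]
    exact Finset.sum_congr rfl fun j _ => by rw [b.orthonormal.inner_right_fintype x j]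
  have hs : sigmaHat (b 0) (∑ j, x j • b j) =
      Real.sqrt ((∑ j : Fin k, x j.succ ^ 2) / (k : ℝ)) := by
    rw [sigmaHat_eq, h1, h2, Fin.sum_univ_succ]
    push_cast
    simp
  have hk : (0 : ℝ) < k := by exact_mod_cast i.pos
  have hpos : 0 < Real.sqrt ((∑ j : Fin k, x j.succ ^ 2) / (k : ℝ)) := by
    refine Real.sqrt_pos.2 (div_pos ?_ hk)
    exact Finset.sum_pos' (fun j _ => sq_nonneg _) ⟨i, Finset.mem_univ i, by positivity⟩
  rw [tStat, hs, h1, if_pos hpos]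

lemma ae_pi_gaussianReal_ne_zero {κ : Type*} [Fintype κ] (i : κ) :
    ∀ᵐ x ∂(Measure.pi fun _ : κ => gaussianReal 0 1), x i ≠ 0 := by
  have := nullSingletonClass_gaussianReal (μ := 0) (v := 1) one_ne_zero
  refine (Measure.quasiMeasurePreserving_eval (μ := fun _ : κ => gaussianReal 0 1) i).ae
    (p := fun y => y ≠ 0) ?_
  simp [ae_iff]

/-- In an orthonormal basis starting with `ι`, the Gaussian coordinates are independent standard
normals, and the statistic becomes the ratio defining Student's law. -/
lemma map_tStat_stdGaussian {n : ℕ} (hn : 2 ≤ n) {ι : E n} (hι : ‖ι‖ = 1) :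
    (stdGaussian (E n)).map (tStat ι) = (studentT (n - 1)).map (fun t : ℝ => (t : EReal)) := by
  obtain ⟨k, rfl⟩ : ∃ k, n = k + 1 := ⟨n - 1, by omega⟩
  obtain ⟨b, hb⟩ : ∃ b : OrthonormalBasis (Fin (k + 1)) ℝ (E (k + 1)), b 0 = ι := by
    have ho : Orthonormal ℝ (({0} : Set (Fin (k + 1))).domRestrict fun _ => ι) := by
      refine ⟨fun _ => hι, fun i j hij => (hij (Subsingleton.elim i j)).elim⟩
    obtain ⟨b, hb⟩ := ho.exists_orthonormalBasis_extension_of_card_eq (by simp)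
    exact ⟨b, hb 0 rfl⟩
  subst hb
  have hpi := (measurePreserving_piFinSuccAbove
    (fun _ : Fin (k + 1) => gaussianReal 0 1) 0).map_eq
  have hmeas : Measurable fun p : ℝ × (Fin k → ℝ) =>
      p.1 / Real.sqrt ((∑ i, p.2 i ^ 2) / (k : ℝ)) := by fun_prop
  rw [stdGaussian_eq_map_pi_orthonormalBasis b,
    Measure.map_map (measurable_tStat _) (by fun_prop), Nat.add_sub_cancel, studentT, ← hpi,
    Measure.map_map measurable_coe_real_ereal hmeas,
    Measure.map_map (measurable_coe_real_ereal.comp hmeas) (MeasurableEquiv.measurable _)]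
  refine Measure.map_congr ?_
  -- `n ≥ 2` provides a coordinate orthogonal to `ι`; it is almost surely nonzero, so `σ̂ > 0`.
  filter_upwards [ae_pi_gaussianReal_ne_zero (Fin.succ (⟨0, by omega⟩ : Fin k))] with x hx
  simp only [Function.comp_apply]
  rw [tStat_sum_smul b x hx]
  rfl

lemma measurable_tStat_act {n : ℕ} (ι x : E n) :
    Measurable fun H : O n => tStat ι (act H x) :=
  (measurable_id.orthAct measurable_const).orthTStat ι

/-- Write `y = G (c x)` with `c > 0`: scale invariance removes `c`, and right invariance of Haar
measure absorbs `G`. -/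
lemma map_tStat_act_eq {n : ℕ} (ι : E n) {x y : E n} (hx : x ≠ 0) (hy : y ≠ 0) :
    (uniformO n).map (fun H => tStat ι (act H y)) =
      (uniformO n).map (fun H => tStat ι (act H x)) := by
  have hx' := norm_pos_iff.2 hx
  have hy' := norm_pos_iff.2 hy
  have hc : 0 < ‖y‖ / ‖x‖ := div_pos hy' hx'
  obtain ⟨G, hG⟩ : ∃ G : O n, act G ((‖y‖ / ‖x‖) • x) = y :=
    exists_act_eq (by rw [norm_smul, Real.norm_of_nonneg hc.le, div_mul_cancel₀ _ hx'.ne'])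
  have hm := measurable_tStat_act ι x
  conv_rhs => rw [← map_mul_right_uniformO G]
  rw [Measure.map_map hm (continuous_mul_const G).measurable]
  congr 1
  ext H
  rw [Function.comp_apply, act_mul, ← hG, act_smul, act_smul, tStat_smul _ _ hc]

lemma map_tStat_act_uniformO {n : ℕ} (hn : 2 ≤ n) {ι : E n} (hι : ‖ι‖ = 1) {x : E n}
    (hx : x ≠ 0) :
    (uniformO n).map (fun H => tStat ι (act H x)) =
      (studentT (n - 1)).map (fun t : ℝ => (t : EReal)) := by
  rw [← map_tStat_stdGaussian hn hι]
  have hmeas : Measurable fun p : O n × E n => tStat ι (act p.1 p.2) :=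
    (measurable_fst.orthAct measurable_snd).orthTStat ι
  have h0 : ∀ᵐ z ∂(stdGaussian (E n)), z ≠ 0 := by
    rw [← map_pi_eq_stdGaussian, ae_map_iff (p := fun z => z ≠ 0) (by fun_prop)
      (measurableSet_singleton 0).compl]
    filter_upwards [ae_pi_gaussianReal_ne_zero (⟨0, by omega⟩ : Fin n)] with z hz h
    exact hz (by simpa using congrArg (fun w : E n => w ⟨0, by omega⟩) h)
  ext s hs
  have hS : MeasurableSet ((fun p : O n × E n => tStat ι (act p.1 p.2)) ⁻¹' s) := hmeas hs
  -- With `H` fixed, rotation invariance of the Gaussian removes `H`.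
  have hprod : ((uniformO n).prod (stdGaussian (E n)))
      ((fun p : O n × E n => tStat ι (act p.1 p.2)) ⁻¹' s) =
      (stdGaussian (E n)).map (tStat ι) s := by
    rw [Measure.prod_apply hS]
    have : ∀ H : O n, (stdGaussian (E n)) (Prod.mk H ⁻¹'
        ((fun p : O n × E n => tStat ι (act p.1 p.2)) ⁻¹' s)) =
        (stdGaussian (E n)).map (tStat ι) s := fun H => by
      conv_rhs => rw [← stdGaussian_map (actIsometry H)]
      rw [Measure.map_map (measurable_tStat ι) (actIsometry H).continuous.measurable,
        Measure.map_apply ((measurable_tStat ι).comp (actIsometry H).continuous.measurable) hs]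
      rfl
    simp [this]
  rw [← hprod, Measure.prod_apply_symm hS]
  -- In the other order of integration, the inner measure is the same for every `z ≠ 0`.
  have : ∀ᵐ z ∂(stdGaussian (E n)), (uniformO n) ((fun H => (H, z)) ⁻¹'
      ((fun p : O n × E n => tStat ι (act p.1 p.2)) ⁻¹' s)) =
      (uniformO n).map (fun H => tStat ι (act H x)) s := by
    filter_upwards [h0] with z hz
    rw [← map_tStat_act_eq ι hx hz,
      Measure.map_apply (measurable_tStat_act ι z) hs]
    rfl
  rw [lintegral_congr_ae this]
  simp

/-! ### Comparison of the two tests -/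

lemma card_filter_fin_cons {m : ℕ} (p : Fin (m + 1) → Prop) [DecidablePred p] (h0 : p 0) :
    (Finset.univ.filter p).card = (Finset.univ.filter fun i : Fin m => p i.succ).card + 1 := by
  rw [Fin.card_filter_univ_succ, if_pos h0]

/-- The Monte Carlo test rejects the value `c` of the statistic, given the other values `w`. -/
def RankRejects {R : Type*} [LinearOrder R] (α : ℝ) {m : ℕ} (c : R) (w : Fin m → R) : Prop :=
  ((Finset.univ.filter fun i => c ≤ w i).card : ℝ) + 1 ≤ α * ((m : ℝ) + 1)

/-- The observed value always counts itself, whence the `+ 1` on the left of `RankRejects`. -/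
lemma upperQuantile_lt_zero_iff {R : Type*} [ConditionallyCompleteLinearOrder R] {α : ℝ}
    (hα0 : 0 < α) (hα1 : α < 1) {m : ℕ} (v : Fin (m + 1) → R) :
    upperQuantile α v < v 0 ↔ RankRejects α (v 0) (fun i => v i.succ) := by
  rw [upperQuantile_lt_iff hα0 hα1, card_filter_fin_cons (fun j => v 0 ≤ v j) le_rfl, RankRejects]
  simp

lemma mcTTest_iff {n : ℕ} (ι : E n) {α : ℝ} (hα0 : 0 < α) (hα1 : α < 1) {M : ℕ} (x : E n)
    (t : Fin (M - 1) → ℝ) :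
    mcTTest ι α M x t ↔ RankRejects α (tStat ι x) (fun i => (t i : EReal)) :=
  upperQuantile_lt_zero_iff hα0 hα1
    (Fin.cons (tStat ι x) (fun i => (t i : EReal)) : Fin (M - 1 + 1) → EReal)

lemma mcGroupTest_iff_inner {n : ℕ} (ι : E n) {α : ℝ} (hα0 : 0 < α) (hα1 : α < 1) {M : ℕ}
    (x : E n) (h : Fin (M - 1) → O n) :
    mcGroupTest ι α M x h ↔
      RankRejects α (inner ℝ ι x : ℝ) (fun i => inner ℝ ι (act (h i) x)) := by
  have := upperQuantile_lt_zero_iff hα0 hα1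
    (fun j => (inner ℝ ι (act (mcGroupSample h j) x) : ℝ))
  simpa only [mcGroupTest, mcGroupSample, Fin.cons_zero, Fin.cons_succ, act_one] using this

lemma mcGroupTest_iff {n : ℕ} (hn : 2 ≤ n) {ι : E n} (hι : ‖ι‖ = 1) {α : ℝ} (hα0 : 0 < α)
    (hα1 : α < 1) {M : ℕ} (x : E n) (h : Fin (M - 1) → O n) :
    mcGroupTest ι α M x h ↔
      RankRejects α (tStat ι x) (fun i => tStat ι (act (h i) x)) := by
  rw [mcGroupTest_iff_inner ι hα0 hα1]
  simp only [RankRejects, tStat_le_tStat_iff hn hι (norm_act _ x).symm]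

lemma not_rankRejects_of_le {R : Type*} [LinearOrder R] {α : ℝ} (hα1 : α < 1) {m : ℕ} {c : R}
    {w : Fin m → R} (h : ∀ i, c ≤ w i) : ¬ RankRejects α c w := by
  simp only [RankRejects, h, Finset.filter_true, Finset.card_univ, Fintype.card_fin, not_le]
  have : (0 : ℝ) < m + 1 := by positivity
  nlinarith

lemma measurableSet_rankRejects (α : ℝ) (m : ℕ) :
    MeasurableSet {p : EReal × (Fin m → EReal) | RankRejects α p.1 p.2} := by
  simp only [RankRejects, Finset.card_filter]
  refine measurableSet_le ?_ measurable_const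
  push_cast
  refine (Finset.measurable_sum _ fun i _ => ?_).add_const 1
  refine Measurable.ite (measurableSet_le measurable_fst ?_) measurable_const measurable_const
  exact (measurable_pi_apply i).comp measurable_snd

lemma map_groupDraws {n : ℕ} (hn : 2 ≤ n) {ι : E n} (hι : ‖ι‖ = 1) {x : E n} (hx : x ≠ 0)
    (M : ℕ) :
    (groupDraws n M).map (fun h i => tStat ι (act (h i) x)) =
      (tDraws (n - 1) M).map (fun t i => (t i : EReal)) := by
  have hm := measurable_tStat_act ι x
  have hprob : IsProbabilityMeasure (studentT (n - 1)) :=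
    Measure.isProbabilityMeasure_map (by fun_prop)
  have := Measure.isProbabilityMeasure_map (μ := studentT (n - 1))
    measurable_coe_real_ereal.aemeasurable
  have := Measure.isProbabilityMeasure_map (μ := uniformO n) hm.aemeasurable
  rw [groupDraws, tDraws, Measure.pi_map_pi (fun _ => hm.aemeasurable),
    Measure.pi_map_pi (fun _ => measurable_coe_real_ereal.aemeasurable),
    map_tStat_act_uniformO hn hι hx]

lemma groupDraws_mcGroupTest_eq {n : ℕ} (hn : 2 ≤ n) {ι : E n} (hι : ‖ι‖ = 1) {α : ℝ}
    (hα0 : 0 < α) (hα1 : α < 1) (M : ℕ) (x : E n) :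
    groupDraws n M {h | mcGroupTest ι α M x h} =
      tDraws (n - 1) M {t | mcTTest ι α M x t} := by
  simp only [mcGroupTest_iff hn hι hα0 hα1, mcTTest_iff ι hα0 hα1]
  -- At the origin all `H x` coincide and the Student law fails; there the observed statistic is
  -- `⊥`, a minimum, which is never rejected.
  by_cases hx : x = 0
  · subst hx
    simp only [tStat_zero, not_rankRejects_of_le hα1 (fun _ => bot_le)]
    simp
  · have hS : MeasurableSet {w : Fin (M - 1) → EReal | RankRejects α (tStat ι x) w} :=
      (measurable_const.prodMk measurable_id) (measurableSet_rankRejects α (M - 1))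
    have h := congrArg (fun m => m {w : Fin (M - 1) → EReal | RankRejects α (tStat ι x) w})
      (map_groupDraws hn hι hx M)
    rw [Measure.map_apply _ hS, Measure.map_apply _ hS] at h
    · exact h
    · exact measurable_pi_lambda _ fun i =>
        measurable_coe_real_ereal.comp (measurable_pi_apply i)
    · exact measurable_pi_lambda _ fun i =>
        ((measurable_pi_apply i).orthAct measurable_const).orthTStat ι

lemma power_eq {n : ℕ} (hn : 2 ≤ n) {ι : E n} (hι : ‖ι‖ = 1) {α : ℝ} (hα0 : 0 < α)
    (hα1 : α < 1) (M : ℕ) (μ : ℝ) (ν : Measure (E n)) :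
    power ι (groupDraws n M) (mcGroupTest ι α M) μ ν =
      power ι (tDraws (n - 1) M) (mcTTest ι α M) μ ν := by
  have hprob : IsProbabilityMeasure (studentT (n - 1)) :=
    Measure.isProbabilityMeasure_map (by fun_prop)
  have hG : IsProbabilityMeasure (groupDraws n M) := by unfold groupDraws; infer_instance
  have hT : IsProbabilityMeasure (tDraws (n - 1) M) := by unfold tDraws; infer_instance
  have mG : MeasurableSet {p : E n × (Fin (M - 1) → O n) |
      mcGroupTest ι α M (μ • ι + p.1) p.2} := by
    simp only [mcGroupTest_iff hn hι hα0 hα1]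
    refine Measurable.prodMk (f := fun p : E n × (Fin (M - 1) → O n) => tStat ι (μ • ι + p.1))
      (g := fun p i => tStat ι (act (p.2 i) (μ • ι + p.1))) ?_ ?_
      (measurableSet_rankRejects α (M - 1))
    · exact (measurable_fst.const_add (μ • ι)).orthTStat ι
    · exact measurable_pi_lambda _ fun i =>
        ((measurable_snd.eval (a := i)).orthAct (measurable_fst.const_add (μ • ι))).orthTStat ι
  have mT : MeasurableSet {p : E n × (Fin (M - 1) → ℝ) |
      mcTTest ι α M (μ • ι + p.1) p.2} := by
    simp only [mcTTest_iff ι hα0 hα1]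
    refine Measurable.prodMk (f := fun p : E n × (Fin (M - 1) → ℝ) => tStat ι (μ • ι + p.1))
      (g := fun p i => ((p.2 i : ℝ) : EReal)) ?_ ?_ (measurableSet_rankRejects α (M - 1))
    · exact (measurable_fst.const_add (μ • ι)).orthTStat ι
    · exact measurable_pi_lambda _ fun i =>
        measurable_coe_real_ereal.comp ((measurable_pi_apply i).comp measurable_snd)
  rw [power, power, Measure.prod_apply mG, Measure.prod_apply mT]
  exact lintegral_congr fun z => groupDraws_mcGroupTest_eq hn hι hα0 hα1 M (μ • ι + z)

end OrthInv

theorem mainTheorem6 (n : ℕ) (hn : 2 ≤ n) (ι : OrthInv.E n) (hι : ‖ι‖ = 1)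
    (M : ℕ) (hM : 1 ≤ M) (α : ℝ) (hα0 : 0 < α) (hα1 : α < 1) :
    OrthInv.size ι (OrthInv.groupDraws n M) (OrthInv.mcGroupTest ι α M)
        = OrthInv.size ι (OrthInv.tDraws (n - 1) M) (OrthInv.mcTTest ι α M) ∧
      ∀ (μ : ℝ) (ν : MeasureTheory.Measure (OrthInv.E n)),
        MeasureTheory.IsProbabilityMeasure ν →
          OrthInv.power ι (OrthInv.groupDraws n M) (OrthInv.mcGroupTest ι α M) μ ν
            = OrthInv.power ι (OrthInv.tDraws (n - 1) M) (OrthInv.mcTTest ι α M) μ ν := by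
  refine ⟨?_, fun μ ν _ => OrthInv.power_eq hn hι hα0 hα1 M μ ν⟩
  simp only [OrthInv.size, OrthInv.power_eq hn hι hα0 hα1 M]
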